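/- Let $n,d\ge 1$ be integers and identify $\mathbb{R}^{n+d}$ with $\mathbb{R}^n\times\mathbb{R}^d$, with the Euclidean norm. A convex body is a compact convex set with nonempty interior; $\mathrm{vol}_r$ denotes the $r$-dimensional Hausdorff measure (in its usual normalization); halfspaces are closed affine halfspaces. For $K\subseteq\mathbb{R}^p$ of Hausdorff dimension $q$, the Oertel radius of $K$ is $$\mathcal F(K)=\sup_{x\in K}\ \inf_{u\in\mathbb{R}^p\setminus\{0\}}\ \frac{\mathrm{vol}_q(\{y\in K: u^\top(y-x)\ge 0\})}{\mathrm{vol}_q(K)}.$$ **Theorem.** Let $C\subset\mathbb{R}^{n+d}$ be a convex body whose projection onto $\mathbb{R}^n$ contains a Euclidean ball of radius $k>0$ (with arbitrary centre), and let $S=C\cap(\mathbb{Z}^n\times\mathbb{R}^d)$. 1. If $S\neq\emptyset$, or if the constant $\frac1e-11\,\frac{d\,n^{3/4}}{k^{1/2}}$ is positive (in which case $S\ne\emptyset$ is part of the conclusion), then there is a point $\mathbf x\in S$ such that every halfspace $H$ containing $\mathbf x$ satisfies $$\mathrm{vol}_d(S\cap H)\ \ge\ \Bigl(\frac1e-11\,\frac{d\,n^{3/4}}{k^{1/2}}\Bigr)\,\mathrm{vol}_d(S).$$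 2. There is a universal constant $\alpha>0$ (independent of $n$, $d$, $C$ and $k$) such that if $k\ge\alpha d^2n^{3/2}$, then $$\mathcal F(S)\ \ge\ \frac1{2^n}\Bigl(\frac{d}{d+1}\Bigr)^d,$$ and hence Oertel's conjecture holds for $C$, that is, $\mathcal F(S)\ge\frac1{2^n}\cdot\frac1e$. -/

import Mathlib

open MeasureTheory MeasureTheory.Measure
open scoped ENNReal

namespace MixedInteger

/-- The Euclidean space `ℝ^(n+d) = ℝ^n × ℝ^d`: the coordinates `Sum.inl i` are those of `ℝ^n`,
the coordinates `Sum.inr j` those of `ℝ^d`. -/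
abbrev Space (n d : ℕ) : Type := EuclideanSpace ℝ (Fin n ⊕ Fin d)

/-- The projection of `ℝ^n × ℝ^d` onto `ℝ^n`. -/
def proj {n d : ℕ} (x : Space n d) : EuclideanSpace ℝ (Fin n) :=
  WithLp.toLp 2 (fun i => x (Sum.inl i))

/-- The set `ℤ^n × ℝ^d`. -/
def lattice (n d : ℕ) : Set (Space n d) :=
  {x | ∀ i : Fin n, ∃ m : ℤ, x (Sum.inl i) = (m : ℝ)}

variable {ι : Type} [Fintype ι]

/-- A convex body: a compact convex set with nonempty interior. -/
structure IsConvexBody (C : Set (EuclideanSpace ℝ ι)) : Prop where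
  convex : Convex ℝ C
  isCompact : IsCompact C
  nonempty_interior : (interior C).Nonempty

/-- The `r`-dimensional Hausdorff measure with its usual normalization
`π^(r/2) / (Γ(r/2 + 1) 2^r)`: a covering set `A` is weighted by the volume
`π^(r/2) / Γ(r/2 + 1) * (diam A / 2)^r` of the `r`-dimensional ball of the same diameter.
(Mathlib's `μH[r]` weights it by `(diam A)^r`.) -/
noncomputable def vol (r : ℝ) : Measure (EuclideanSpace ℝ ι) :=
  ENNReal.ofReal (Real.pi ^ (r / 2) / Real.Gamma (r / 2 + 1) / 2 ^ r) • μH[r]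

/-- The halfspace `H(u, x) = {y | uᵀ (y - x) ≥ 0}`. -/
def halfspaceAt (u x : EuclideanSpace ℝ ι) : Set (EuclideanSpace ℝ ι) :=
  {y | 0 ≤ inner ℝ u (y - x)}

/-- The (closed, affine) halfspaces `{y | uᵀ y ≥ b}` with `u ≠ 0`. -/
def IsHalfspace (H : Set (EuclideanSpace ℝ ι)) : Prop :=
  ∃ u : EuclideanSpace ℝ ι, u ≠ 0 ∧ ∃ b : ℝ, H = {y | b ≤ inner ℝ u y}

/-- The Oertel radius of `K`: with `q` the Hausdorff dimension of `K`, the supremum over `x ∈ K` of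
the infimum over `u ≠ 0` of `vol_q (H(u, x) ∩ K) / vol_q K`. -/
noncomputable def oertelRadius (K : Set (EuclideanSpace ℝ ι)) : ℝ≥0∞ :=
  ⨆ x ∈ K, ⨅ (u : EuclideanSpace ℝ ι) (_ : u ≠ 0),
    vol (dimH K).toReal (halfspaceAt u x ∩ K) / vol (dimH K).toReal K

end MixedInteger

/-!
The theorem is a mixed-integer version of Grünbaum's inequality: if the projection of a convex body
`C ⊆ ℝ^n × ℝ^d` onto `ℝ^n` is large, summing the volumes of the fibres of `C` over `ℤ^n` is almost
the same as integrating them over `ℝ^n`, uniformly over all halfspaces.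

*Lebesgue measure.* A halfspace through the centroid of a convex body contains at least `1 / e` of
its volume (`gruenbaum`). By the Prékopa–Leindler inequality, the tail function `F t = P (X ≥ t)` of
a linear functional `X` of a uniform random point is log-concave. Jensen's inequality gives
`log (F (E X)) ≥ E (log (F X))`, and the right side is at least `-1` because `F X` dominates a
uniform variable on `[0, 1]` (`exp_neg_one_le_measure_Ici_mean`).

*From sums to integrals.* Suppose that the projection of `K` contains a cube of half-side `r` with
centre `a`, and put `s = 1 / r`. Each vector `w` of the unit cube is then `s (q₁ - a)` for the
projection `q₁` of some `q ∈ K`. Hence a fibre of `A` over a lattice point `z` can be translated by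
`s q` into the fibre of `A + s K` over any `x + s a` with `x` in the unit cube at `z`, and
conversely (`latticeVol_le_volume`, `volume_le_latticeVol`). Applied to dilates of `K`, this bounds
the lattice sum of `K` by `(1 + s)^(n+d)` times the volume of `K`, and from below, for the part of
`K` in a halfspace, by `(1 - s)^(n+d)` times the volume of the part in a slightly smaller
halfspace.

*The point.* With `c` the centroid and a suitable `q ∈ K`, the point `x = (1 - s) c + s q` has
integral first coordinates. If a halfspace `u ≥ b` contains `x`, contracting `K` by the factor
`1 - s` towards a point where `u` is maximal carries `u ≥ u c` into `u ≥ b`; contracting towards a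
point where `u` is minimal compares `u ≥ b` with the smaller halfspace of the previous paragraph.
Altogether the fraction is at least `1 / e - 2 (n + d) s` (`exists_deep_lattice_point`). A
Euclidean ball of radius `k` contains a cube with `r = k / √n`, so the loss is
`2 (n + d) √n / k ≤ 4 t ^ 2` with `t = d n^(3/4) / k^(1/2)`. This is at most `11 t` whenever
`11 t < 1 / e`, and the first part is trivial otherwise. For the second part, both lower bounds are
at most `1 / 4`, while `1 / e - 4 t ^ 2` exceeds `1 / 4` once `k` is a large multiple of
`d^2 n^(3/2)`.
-/

namespace MixedInteger

/-! ### The Prékopa–Leindler inequality -/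

section PrekopaLeindlerInequality

open scoped Pointwise

/-- The one-dimensional Brunn–Minkowski inequality. For compact sets, the translates `A + min B`
and `max A + B` both lie in `A + B` and meet in one point; inner regularity gives the rest. -/
lemma volume_add_volume_le {A B D : Set ℝ} (hA : MeasurableSet A) (hB : MeasurableSet B)
    (hA0 : A.Nonempty) (hB0 : B.Nonempty) (h : ∀ a ∈ A, ∀ b ∈ B, a + b ∈ D) :
    volume A + volume B ≤ volume D := by
  have key : ∀ K L : Set ℝ, K ⊆ A → L ⊆ B → IsCompact K → IsCompact L → K.Nonempty →
      L.Nonempty → volume K + volume L ≤ volume D := by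
    intro K L hK hL hKc hLc hK0 hL0
    obtain ⟨a, haK, ha⟩ := hKc.exists_isGreatest hK0
    obtain ⟨b, hbL, hb⟩ := hLc.exists_isLeast hL0
    have h1 : volume K ≤ volume (D ∩ Set.Iic (a + b)) := by
      rw [← measure_preimage_add_right volume (-b) K]
      refine measure_mono fun x hx => ?_
      have hx' : x + -b ∈ K := hx
      refine ⟨?_, ?_⟩
      · have := h _ (hK hx') b (hL hbL)
        simpa using this
      · have := ha hx'
        simp only [Set.mem_Iic]; linarith
    have h2 : volume L ≤ volume (D ∩ Set.Ici (a + b)) := by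
      rw [← measure_preimage_add volume (-a) L]
      refine measure_mono fun x hx => ?_
      have hx' : -a + x ∈ L := hx
      refine ⟨?_, ?_⟩
      · have := h a (hK haK) _ (hL hx')
        simpa using this
      · have := hb hx'
        simp only [Set.mem_Ici]; linarith
    have h3 : volume (D ∩ Set.Ici (a + b)) ≤ volume (D \ Set.Iic (a + b)) := by
      have : D ∩ Set.Ici (a + b) ⊆ (D \ Set.Iic (a + b)) ∪ {a + b} := by
        rintro x ⟨hx, hx'⟩
        rcases eq_or_lt_of_le (show a + b ≤ x from hx') with h' | h'
        · right; simp [h']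
        · left; exact ⟨hx, by simpa using h'⟩
      refine (measure_mono this).trans ((measure_union_le _ _).trans ?_)
      simp
    calc volume K + volume L ≤ volume (D ∩ Set.Iic (a + b)) + volume (D \ Set.Iic (a + b)) :=
          add_le_add h1 (h2.trans h3)
      _ = volume D := measure_inter_add_sdiff _ measurableSet_Iic
  obtain ⟨a, ha⟩ := hA0
  obtain ⟨b, hb⟩ := hB0
  rw [hA.measure_eq_iSup_isCompact, hB.measure_eq_iSup_isCompact]
  simp only [iSup_and']
  refine ENNReal.biSup_add_biSup_le' (p := fun K : Set ℝ => K ⊆ A ∧ IsCompact K)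
    (q := fun K : Set ℝ => K ⊆ B ∧ IsCompact K)
    ⟨∅, by simp⟩ ⟨∅, by simp⟩ ?_
  rintro K ⟨hK, hKc⟩ L ⟨hL, hLc⟩
  refine (add_le_add (measure_mono (Set.subset_insert a K))
    (measure_mono (Set.subset_insert b L))).trans
    (key (insert a K) (insert b L) (Set.insert_subset ha hK) (Set.insert_subset hb hL)
      (hKc.insert a) (hLc.insert b) (Set.insert_nonempty _ _) (Set.insert_nonempty _ _))

/-- The Brunn–Minkowski inequality on the line for convex combinations of two sets. -/
lemma volume_convexComb_le {A B D : Set ℝ} {θ : ℝ} (h0 : 0 < θ) (h1 : θ < 1)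
    (hA : MeasurableSet A) (hB : MeasurableSet B)
    (hA0 : A.Nonempty) (hB0 : B.Nonempty) (h : ∀ a ∈ A, ∀ b ∈ B, (1 - θ) * a + θ * b ∈ D) :
    ENNReal.ofReal (1 - θ) * volume A + ENNReal.ofReal θ * volume B ≤ volume D := by
  have hθ : 0 < 1 - θ := by linarith
  have e1 : volume ((1 - θ) • A) = ENNReal.ofReal (1 - θ) * volume A := by
    rw [Measure.addHaar_smul]; simp [abs_of_pos hθ]
  have e2 : volume (θ • B) = ENNReal.ofReal θ * volume B := by
    rw [Measure.addHaar_smul]; simp [abs_of_pos h0]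
  rw [← e1, ← e2]
  refine volume_add_volume_le (hA.const_smul_of_ne_zero hθ.ne') (hB.const_smul_of_ne_zero h0.ne')
    (hA0.smul_set) (hB0.smul_set) ?_
  rintro _ ⟨a, ha, rfl⟩ _ ⟨b, hb, rfl⟩
  exact h a ha b hb

lemma geom_mean_le_arith_mean_ennreal {θ : ℝ} (h0 : 0 < θ) (h1 : θ < 1) (x y : ℝ≥0∞) :
    x ^ (1 - θ) * y ^ θ ≤ ENNReal.ofReal (1 - θ) * x + ENNReal.ofReal θ * y := by
  have hθ : 0 < 1 - θ := by linarith
  induction x with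
  | top => rw [ENNReal.mul_top (by simpa using hθ)]; simp
  | coe x =>
    induction y with
    | top => rw [ENNReal.mul_top (by simpa using h0)]; simp
    | coe y =>
      rw [← ENNReal.coe_rpow_of_nonneg _ hθ.le, ← ENNReal.coe_rpow_of_nonneg _ h0.le]
      simp only [ENNReal.ofReal]
      norm_cast
      have := NNReal.geom_mean_le_arith_mean2_weighted (1 - θ).toNNReal θ.toNNReal x y
        (by rw [← Real.toNNReal_add hθ.le h0.le]; simp)
      rwa [Real.coe_toNNReal _ hθ.le, Real.coe_toNNReal _ h0.le] at this

/-- The Prékopa–Leindler inequality on the line for functions normalized to have supremum `1`: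
apply Brunn–Minkowski to the superlevel sets, none of which is empty below level `1`, and
integrate over the level. -/
lemma lintegral_convexComb_le_of_sup_eq_one {f g : ℝ → ℝ} {h : ℝ → ℝ≥0∞} {θ : ℝ}
    (h0 : 0 < θ) (h1 : θ < 1)
    (hf : Measurable f) (hg : Measurable g) (hh : Measurable h)
    (hf0 : ∀ x, 0 ≤ f x) (hg0 : ∀ x, 0 ≤ g x) (hf1 : ∀ x, f x ≤ 1) (hg1 : ∀ x, g x ≤ 1)
    (hfs : ∀ t < 1, ∃ x, t < f x) (hgs : ∀ t < 1, ∃ x, t < g x)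
    (hfg : ∀ x y t, 0 < t → t < f x → t < g y → ENNReal.ofReal t ≤ h ((1 - θ) * x + θ * y)) :
    ENNReal.ofReal (1 - θ) * (∫⁻ x, ENNReal.ofReal (f x))
      + ENNReal.ofReal θ * (∫⁻ x, ENNReal.ofReal (g x)) ≤ ∫⁻ x, h x := by
  set k : ℝ → ℝ := fun x => (min (h x) 1).toReal with hk
  have hkm : Measurable k := (hh.min measurable_const).ennreal_toReal
  have hne : ∀ x, min (h x) 1 ≠ ∞ := fun x => ne_top_of_le_ne_top ENNReal.one_ne_top (min_le_right _ _)
  have step : ∫⁻ x, ENNReal.ofReal (k x) ≤ ∫⁻ x, h x := by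
    refine lintegral_mono fun x => ?_
    simp only [hk]
    rw [ENNReal.ofReal_toReal (hne x)]
    exact min_le_left _ _
  refine le_trans ?_ step
  rw [lintegral_eq_lintegral_meas_lt volume (.of_forall hf0) hf.aemeasurable,
    lintegral_eq_lintegral_meas_lt volume (.of_forall hg0) hg.aemeasurable,
    lintegral_eq_lintegral_meas_le volume (.of_forall fun x => ENNReal.toReal_nonneg)
      hkm.aemeasurable]
  have mf : Measurable fun t : ℝ => volume {a | t < f a} :=
    Antitone.measurable fun s t hst => measure_mono fun x hx => lt_of_le_of_lt hst hx
  have mg : Measurable fun t : ℝ => volume {a | t < g a} :=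
    Antitone.measurable fun s t hst => measure_mono fun x hx => lt_of_le_of_lt hst hx
  rw [← lintegral_const_mul _ mf, ← lintegral_const_mul _ mg,
    ← lintegral_add_left (mf.const_mul _)]
  refine setLIntegral_mono' measurableSet_Ioi fun t ht => ?_
  rcases lt_or_ge t 1 with ht1 | ht1
  · refine volume_convexComb_le h0 h1 (hf measurableSet_Ioi) (hg measurableSet_Ioi)
      (hfs t ht1) (hgs t ht1) ?_
    intro a ha b hb
    have := hfg a b t ht ha hb
    simp only [Set.mem_ofPred_eq]
    rw [← ENNReal.ofReal_le_iff_le_toReal (hne _)]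
    exact le_min this (by simpa using ht1.le)
  · have e1 : {a | t < f a} = ∅ := by
      ext x; simpa using (hf1 x).trans ht1
    have e2 : {a | t < g a} = ∅ := by
      ext x; simpa using (hg1 x).trans ht1
    simp [e1, e2]

/-- The measure `μ` satisfies the Prékopa–Leindler inequality. -/
def PrekopaLeindler {E : Type*} [AddCommGroup E] [Module ℝ E] [MeasurableSpace E]
    (μ : Measure E) : Prop :=
  ∀ (θ : ℝ), 0 < θ → θ < 1 → ∀ f g h : E → ℝ≥0∞, Measurable f → Measurable g → Measurable h →
    (∀ x y, f x ^ (1 - θ) * g y ^ θ ≤ h ((1 - θ) • x + θ • y)) →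
    (∫⁻ x, f x ∂μ) ^ (1 - θ) * (∫⁻ x, g x ∂μ) ^ θ ≤ ∫⁻ x, h x ∂μ

/-- Reduction to functions of supremum `1`, using that the inequality is homogeneous of degree
`1 - θ` in `f`, of degree `θ` in `g` and of degree `1` in `h`. -/
lemma prekopaLeindler_real_of_bounded {θ : ℝ} (h0 : 0 < θ) (h1 : θ < 1) {f g h : ℝ → ℝ≥0∞}
    (hf : Measurable f) (hg : Measurable g) (hh : Measurable h)
    (hfb : ⨆ x, f x ≠ ∞) (hgb : ⨆ x, g x ≠ ∞)
    (hfg : ∀ x y, f x ^ (1 - θ) * g y ^ θ ≤ h ((1 - θ) * x + θ * y)) :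
    (∫⁻ x, f x) ^ (1 - θ) * (∫⁻ x, g x) ^ θ ≤ ∫⁻ x, h x := by
  have hθ : 0 < 1 - θ := by linarith
  set F := ⨆ x, f x with hF
  set G := ⨆ x, g x with hG
  rcases eq_or_ne F 0 with hF0 | hF0
  · have : ∀ x, f x = 0 := fun x => le_antisymm (hF0 ▸ le_iSup f x) (zero_le)
    simp [this, hθ]
  rcases eq_or_ne G 0 with hG0 | hG0
  · have : ∀ x, g x = 0 := fun x => le_antisymm (hG0 ▸ le_iSup g x) (zero_le)
    simp [this, h0]
  have dle : ∀ x, f x / F ≤ 1 := fun x => ENNReal.div_le_of_le_mul (by simpa using le_iSup f x)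
  have dle' : ∀ x, g x / G ≤ 1 := fun x => ENNReal.div_le_of_le_mul (by simpa using le_iSup g x)
  have dne : ∀ x, f x / F ≠ ∞ := fun x => ne_top_of_le_ne_top ENNReal.one_ne_top (dle x)
  have dne' : ∀ x, g x / G ≠ ∞ := fun x => ne_top_of_le_ne_top ENNReal.one_ne_top (dle' x)
  set M := F ^ (1 - θ) * G ^ θ with hM
  have hM0 : M ≠ 0 := by
    simp [hM, ENNReal.rpow_eq_zero_iff, hF0, hG0, hfb, hgb]
  have hMt : M ≠ ∞ :=
    ENNReal.mul_ne_top (ENNReal.rpow_ne_top_of_nonneg hθ.le hfb)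
      (ENNReal.rpow_ne_top_of_nonneg h0.le hgb)
  have key := lintegral_convexComb_le_of_sup_eq_one (f := fun x => (f x / F).toReal)
    (g := fun x => (g x / G).toReal) (h := fun x => h x / M) h0 h1
    (hf.div_const F).ennreal_toReal (hg.div_const G).ennreal_toReal (hh.div_const M)
    (fun x => ENNReal.toReal_nonneg) (fun x => ENNReal.toReal_nonneg)
    (fun x => by simpa using ENNReal.toReal_mono ENNReal.one_ne_top (dle x))
    (fun x => by simpa using ENNReal.toReal_mono ENNReal.one_ne_top (dle' x))
    ?_ ?_ ?_
  · simp only [ENNReal.ofReal_toReal (dne _), ENNReal.ofReal_toReal (dne' _)] at key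
    have key2 := (geom_mean_le_arith_mean_ennreal h0 h1 _ _).trans key
    simp only [div_eq_mul_inv] at key2
    rw [lintegral_mul_const _ hf, lintegral_mul_const _ hg, lintegral_mul_const _ hh,
      ENNReal.mul_rpow_of_nonneg _ _ hθ.le, ENNReal.mul_rpow_of_nonneg _ _ h0.le,
      ENNReal.inv_rpow, ENNReal.inv_rpow] at key2
    calc (∫⁻ x, f x) ^ (1 - θ) * (∫⁻ x, g x) ^ θ
        = (∫⁻ x, f x) ^ (1 - θ) * (∫⁻ x, g x) ^ θ * (M⁻¹ * M) := by
          rw [ENNReal.inv_mul_cancel hM0 hMt, mul_one]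
      _ = ((∫⁻ x, f x) ^ (1 - θ) * (F ^ (1 - θ))⁻¹ * ((∫⁻ x, g x) ^ θ * (G ^ θ)⁻¹)) * M := by
          conv_lhs => rw [show M⁻¹ = (F ^ (1 - θ))⁻¹ * (G ^ θ)⁻¹ from
            ENNReal.mul_inv (Or.inr (ENNReal.rpow_ne_top_of_nonneg h0.le hgb))
              (Or.inl (ENNReal.rpow_ne_top_of_nonneg hθ.le hfb))]
          ring
      _ ≤ (∫⁻ x, h x) * M⁻¹ * M := by gcongr
      _ = ∫⁻ x, h x := by rw [mul_assoc, ENNReal.inv_mul_cancel hM0 hMt, mul_one]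
  · intro t ht
    have : ENNReal.ofReal t * F < F := by
      conv_rhs => rw [← one_mul F]
      exact ENNReal.mul_lt_mul_left hF0 hfb (by simpa using ht)
    obtain ⟨x, hx⟩ := lt_iSup_iff.1 this
    refine ⟨x, lt_of_le_of_lt (le_max_left t 0) ?_⟩
    rw [← ENNReal.toReal_ofReal']
    exact ENNReal.toReal_strict_mono (dne x)
      ((ENNReal.lt_div_iff_mul_lt (Or.inl hF0) (Or.inl hfb)).2 hx)
  · intro t ht
    have : ENNReal.ofReal t * G < G := by
      conv_rhs => rw [← one_mul G]
      exact ENNReal.mul_lt_mul_left hG0 hgb (by simpa using ht)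
    obtain ⟨x, hx⟩ := lt_iSup_iff.1 this
    refine ⟨x, lt_of_le_of_lt (le_max_left t 0) ?_⟩
    rw [← ENNReal.toReal_ofReal']
    exact ENNReal.toReal_strict_mono (dne' x)
      ((ENNReal.lt_div_iff_mul_lt (Or.inl hG0) (Or.inl hgb)).2 hx)
  · intro x y t ht hx hy
    have hx' : ENNReal.ofReal t ≤ f x / F := (ENNReal.ofReal_le_iff_le_toReal (dne x)).2 hx.le
    have hy' : ENNReal.ofReal t ≤ g y / G := (ENNReal.ofReal_le_iff_le_toReal (dne' y)).2 hy.le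
    rw [ENNReal.le_div_iff_mul_le (Or.inl hM0) (Or.inl hMt)]
    have hx2 := ENNReal.mul_le_of_le_div hx'
    have hy2 := ENNReal.mul_le_of_le_div hy'
    refine le_trans ?_ (hfg x y)
    calc ENNReal.ofReal t * M
        = (ENNReal.ofReal t * F) ^ (1 - θ) * (ENNReal.ofReal t * G) ^ θ := by
          rw [ENNReal.mul_rpow_of_nonneg _ _ hθ.le, ENNReal.mul_rpow_of_nonneg _ _ h0.le, hM]
          have : ENNReal.ofReal t = ENNReal.ofReal t ^ (1 - θ) * ENNReal.ofReal t ^ θ := by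
            rw [← ENNReal.rpow_add _ _ (by simpa using ht) ENNReal.ofReal_ne_top]; simp
          conv_lhs => rw [this]
          ring
      _ ≤ _ := by gcongr

/-- The Prékopa–Leindler inequality on the line, by truncation and monotone convergence. -/
theorem prekopaLeindler_real : PrekopaLeindler (volume : Measure ℝ) := by
  intro θ h0 h1 f g h hf hg hh hfg
  have hθ : 0 < 1 - θ := by linarith
  have key : ∀ N : ℕ, (∫⁻ x, min (f x) N) ^ (1 - θ) * (∫⁻ x, min (g x) N) ^ θ ≤ ∫⁻ x, h x := by
    intro N
    refine prekopaLeindler_real_of_bounded h0 h1 (hf.min measurable_const)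
      (hg.min measurable_const) hh ?_ ?_ ?_
    · exact ne_top_of_le_ne_top (ENNReal.natCast_ne_top N) (iSup_le fun x => min_le_right _ _)
    · exact ne_top_of_le_ne_top (ENNReal.natCast_ne_top N) (iSup_le fun x => min_le_right _ _)
    · intro x y
      refine le_trans ?_ (hfg x y)
      gcongr <;> exact min_le_left _ _
  have lim : ∀ f : ℝ → ℝ≥0∞, Measurable f →
      Filter.Tendsto (fun N : ℕ => ∫⁻ x, min (f x) N) Filter.atTop (nhds (∫⁻ x, f x)) := by
    intro f hf
    refine lintegral_tendsto_of_tendsto_of_monotone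
      (fun N => (hf.min measurable_const).aemeasurable) (.of_forall fun x => ?_)
      (.of_forall fun x => ?_)
    · intro a b hab
      exact min_le_min_left _ (by exact_mod_cast hab)
    · have := (tendsto_const_nhds (x := f x)).min ENNReal.tendsto_nat_nhds_top
      simpa using this
  rcases eq_or_ne (∫⁻ x, f x) 0 with hf0 | hf0
  · simp [hf0, hθ]
  rcases eq_or_ne (∫⁻ x, g x) 0 with hg0 | hg0
  · simp [hg0, h0]
  refine le_of_tendsto' (ENNReal.Tendsto.mul
    ((ENNReal.continuous_rpow_const.tendsto _).comp (lim f hf)) (Or.inl ?_)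
    ((ENNReal.continuous_rpow_const.tendsto _).comp (lim g hg)) (Or.inl ?_)) key
  · simp [ENNReal.rpow_eq_zero_iff, hf0, hθ.not_gt]
  · simp [ENNReal.rpow_eq_zero_iff, hg0, h0.not_gt]

/-- The inequality tensorizes: apply it to the fibre integrals. -/
theorem PrekopaLeindler.prod {E F : Type*} [AddCommGroup E] [Module ℝ E] [MeasurableSpace E]
    [AddCommGroup F] [Module ℝ F] [MeasurableSpace F] {μ : Measure E} {ν : Measure F}
    [SFinite μ] [SFinite ν] (hμ : PrekopaLeindler μ) (hν : PrekopaLeindler ν) :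
    PrekopaLeindler (μ.prod ν) := by
  intro θ h0 h1 f g h hf hg hh hfg
  rw [lintegral_prod _ hf.aemeasurable, lintegral_prod _ hg.aemeasurable,
    lintegral_prod _ hh.aemeasurable]
  refine hμ θ h0 h1 _ _ _ hf.lintegral_prod_right' hg.lintegral_prod_right'
    hh.lintegral_prod_right' fun x x' => ?_
  exact hν θ h0 h1 _ _ _ (hf.comp measurable_prodMk_left) (hg.comp measurable_prodMk_left)
    (hh.comp measurable_prodMk_left) fun y y' => hfg (x, y) (x', y')

theorem PrekopaLeindler.of_measurePreserving {E F : Type*} [AddCommGroup E] [Module ℝ E]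
    [MeasurableSpace E] [AddCommGroup F] [Module ℝ F] [MeasurableSpace F] {μ : Measure E}
    {ν : Measure F} (hμ : PrekopaLeindler μ) (φ : E →ₗ[ℝ] F) (hφ : MeasurePreserving φ μ ν) :
    PrekopaLeindler ν := by
  intro θ h0 h1 f g h hf hg hh hfg
  rw [← hφ.lintegral_comp hf, ← hφ.lintegral_comp hg, ← hφ.lintegral_comp hh]
  refine hμ θ h0 h1 _ _ _ (hf.comp hφ.measurable) (hg.comp hφ.measurable)
    (hh.comp hφ.measurable) fun x y => ?_
  simpa using hfg (φ x) (φ y)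

theorem prekopaLeindler_pi (n : ℕ) : PrekopaLeindler (volume : Measure (Fin n → ℝ)) := by
  induction n with
  | zero =>
    intro θ h0 h1 f g h hf hg hh hfg
    have := hfg 0 0
    have e : ∀ x : Fin 0 → ℝ, x = 0 := fun x => Subsingleton.elim _ _
    have hv : (volume : Measure (Fin 0 → ℝ)) = Measure.dirac 0 := by
      rw [volume_pi, Measure.pi_of_empty _ 0]
    rw [hv, lintegral_dirac, lintegral_dirac, lintegral_dirac]
    simpa using this
  | succ n ih =>
    refine (prekopaLeindler_real.prod ih).of_measurePreserving
      (Fin.consLinearEquiv ℝ (fun _ : Fin (n + 1) => ℝ)).toLinearMap ?_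
    have := (volume_preserving_piFinSuccAbove (fun _ : Fin (n + 1) => ℝ) 0).symm
    have e : ⇑(Fin.consLinearEquiv ℝ (fun _ : Fin (n + 1) => ℝ)).toLinearMap
        = ⇑(MeasurableEquiv.piFinSuccAbove (fun _ : Fin (n + 1) => ℝ) 0).symm := by
      funext p i
      refine Fin.cases ?_ (fun i => ?_) i <;> simp [Fin.consLinearEquiv]
    rw [e]
    exact this

end PrekopaLeindlerInequality

/-! ### Grünbaum's inequality -/

section Gruenbaum

lemma exists_supporting_line {S : Set ℝ} {f : ℝ → ℝ} (hf : ConvexOn ℝ S f) {x : ℝ}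
    (hx : x ∈ interior S) : ∃ κ : ℝ, ∀ y ∈ S, f x + κ * (y - x) ≤ f y := by
  refine ⟨derivWithin f (Set.Ioi x) x, fun y hy => ?_⟩
  rcases lt_trichotomy x y with h | rfl | h
  · have := hf.rightDeriv_le_slope_of_mem_interior hx hy h
    rw [slope_def_field, le_div_iff₀ (by linarith)] at this
    linarith
  · simp
  · have := (hf.slope_le_leftDeriv_of_mem_interior hy hx h).trans
      (hf.leftDeriv_le_rightDeriv_of_mem_interior hx)
    rw [slope_def_field, div_le_iff₀ (by linarith)] at this
    linarith

/-- If `X` has law `ν` and tail function `F t = P (X ≥ t)`, then `P (F X ≤ v) ≤ v`. -/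
lemma measure_tail_le_le (ν : Measure ℝ) [IsFiniteMeasure ν] (v : ℝ≥0∞) :
    ν {x | ν (Set.Ici x) ≤ v} ≤ v := by
  have hm : Measurable fun x => ν (Set.Ici x) :=
    Antitone.measurable fun s t hst => measure_mono (Set.Ici_subset_Ici.2 hst)
  have hT : MeasurableSet {x | ν (Set.Ici x) ≤ v} := hm measurableSet_Iic
  rw [hT.measure_eq_iSup_isCompact]
  refine iSup_le fun K => iSup_le fun hK => iSup_le fun hKc => ?_
  rcases K.eq_empty_or_nonempty with rfl | h0
  · simp
  obtain ⟨a, haK, ha⟩ := hKc.exists_isLeast h0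
  exact (measure_mono fun x hx => ha hx).trans (hK haK)

/-- The one-dimensional Grünbaum inequality. With `F t = P (X ≥ t)`, Jensen's inequality for the
concave function `log F` gives `log (F (E X)) ≥ E (log (F X))`, and the right side is at least `-1`
because `-log (F X)` is stochastically dominated by an exponential variable of mean `1`. -/
lemma exp_neg_one_le_measure_Ici_mean (ν : Measure ℝ) [IsProbabilityMeasure ν]
    (hi : Integrable (fun x => x) ν)
    (hlc : ∀ s t θ : ℝ, 0 < θ → θ < 1 →
      ν (Set.Ici s) ^ (1 - θ) * ν (Set.Ici t) ^ θ ≤ ν (Set.Ici ((1 - θ) * s + θ * t))) :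
    ENNReal.ofReal (Real.exp (-1)) ≤ ν (Set.Ici (∫ x, x ∂ν)) := by
  set m := ∫ x, x ∂ν with hm
  by_cases hA : ∀ t > m, ν (Set.Ici t) = 0
  · -- the variable is almost surely equal to its mean
    have h1 : ν (Set.Ioi m) = 0 := by
      refine le_antisymm ((measure_mono fun t ht => ?_).trans (measure_tail_le_le ν 0)) (zero_le)
      exact (hA t ht).le
    have h2 : ∀ᵐ x ∂ν, x ≤ m := by
      rw [ae_iff]; simpa [Set.Ioi] using h1
    have h3 : ∫ x, (m - x) ∂ν = 0 := by
      rw [integral_sub (integrable_const _) hi]; simp [hm]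
    have h4 := (integral_eq_zero_iff_of_nonneg_ae (h2.mono fun x hx => by simpa using hx)
      ((integrable_const m).sub hi)).1 h3
    have h5 : ν (Set.Ici m) = 1 := by
      rw [prob_compl_eq_zero_iff measurableSet_Ici |>.symm]
      refine measure_mono_null ?_ (ae_iff.1 h4)
      intro x hx
      simp only [Set.mem_compl_iff, Set.mem_Ici, not_le] at hx
      simp only [Pi.sub_apply, Pi.zero_apply, Set.mem_ofPred_eq]
      linarith
    rw [h5]
    simp
  · push Not at hA
    obtain ⟨t₁, ht₁, hF₁⟩ := hA
    set F : ℝ → ℝ := fun t => ν.real (Set.Ici t) with hF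
    have hFE : ∀ t, ν (Set.Ici t) = ENNReal.ofReal (F t) := fun t => by simp [hF]
    set S : Set ℝ := {t | 0 < F t} with hS
    have hlcR : ∀ s t θ : ℝ, 0 < θ → θ < 1 →
        F s ^ (1 - θ) * F t ^ θ ≤ F ((1 - θ) * s + θ * t) := by
      intro s t θ h0 h1
      have := ENNReal.toReal_mono (measure_ne_top _ _) (hlc s t θ h0 h1)
      rwa [ENNReal.toReal_mul, ← ENNReal.toReal_rpow, ← ENNReal.toReal_rpow] at this
    have hanti : Antitone F := fun s t hst => measureReal_mono (Set.Ici_subset_Ici.2 hst)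
    have hconv : ConvexOn ℝ S (fun t => -Real.log (F t)) := by
      have : ConcaveOn ℝ S (fun t => Real.log (F t)) := by
        have hmem : ∀ x ∈ S, ∀ y ∈ S, ∀ a b : ℝ, 0 < a → 0 < b → a + b = 1 →
            a * Real.log (F x) + b * Real.log (F y) ≤ Real.log (F (a * x + b * y)) ∧
              0 < F (a * x + b * y) := by
          intro x hx y hy a b ha hb hab
          have := hlcR x y b hb (by linarith)
          rw [show 1 - b = a by linarith] at this
          have hpx : 0 < F x ^ a := Real.rpow_pos_of_pos hx _
          have hpy : 0 < F y ^ b := Real.rpow_pos_of_pos hy _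
          refine ⟨?_, (mul_pos hpx hpy).trans_le this⟩
          have h2 := Real.log_le_log (mul_pos hpx hpy) this
          rwa [Real.log_mul hpx.ne' hpy.ne', Real.log_rpow hx, Real.log_rpow hy] at h2
        rw [concaveOn_iff_forall_pos]
        refine ⟨?_, fun x hx y hy a b ha hb hab => (hmem x hx y hy a b ha hb hab).1⟩
        rw [convex_iff_forall_pos]
        exact fun x hx y hy a b ha hb hab => (hmem x hx y hy a b ha hb hab).2
      exact this.neg
    have hF₁' : 0 < F t₁ := ENNReal.toReal_pos hF₁ (measure_ne_top _ _)
    have hmS : m ∈ interior S :=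
      interior_mono (s := Set.Iio t₁) (fun t ht => hF₁'.trans_le (hanti (le_of_lt ht)))
        (by simpa using ht₁)
    have hFm : 0 < F m := (interior_subset hmS : m ∈ S)
    obtain ⟨κ, hκ⟩ := exists_supporting_line hconv hmS
    set l : ℝ → ℝ := fun x => -Real.log (F m) + κ * (x - m) with hl
    have hli : Integrable l ν := (integrable_const _).add ((hi.sub (integrable_const _)).const_mul _)
    have hlint : ∫ x, l x ∂ν = -Real.log (F m) := by
      simp only [hl]
      have hi' : Integrable (fun x => x - m) ν := hi.sub (integrable_const _)
      rw [integral_add (integrable_const _) (hi'.const_mul _),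
        integral_const_mul, integral_sub hi (integrable_const _)]
      simp [hm]
    have htail : ∀ s > 0, ν {x | s ≤ max (l x) 0} ≤ ENNReal.ofReal (Real.exp (-s)) := by
      intro s hs
      refine (measure_mono fun x hx => ?_).trans (measure_tail_le_le ν _)
      have hx' : s ≤ l x := by
        rcases le_max_iff.1 (show s ≤ max (l x) 0 from hx) with h | h
        · exact h
        · linarith
      simp only [Set.mem_ofPred_eq, hFE]
      refine ENNReal.ofReal_le_ofReal ?_
      by_cases hxS : x ∈ S
      · have h1 := hx'.trans (hκ x hxS)
        rw [← Real.exp_log (show 0 < F x from hxS)]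
        exact Real.exp_le_exp.2 (by linarith)
      · exact (not_lt.1 hxS).trans (Real.exp_pos _).le
    have hle : ∫⁻ x, ENNReal.ofReal (max (l x) 0) ∂ν ≤ 1 := by
      rw [lintegral_eq_lintegral_meas_le ν (f := fun x => max (l x) 0)
        (.of_forall fun x => le_max_right _ _) (hli.aemeasurable.max aemeasurable_const)]
      calc ∫⁻ s in Set.Ioi (0 : ℝ), ν {x | s ≤ max (l x) 0}
          ≤ ∫⁻ s in Set.Ioi (0 : ℝ), ENNReal.ofReal (Real.exp (-s)) :=
            setLIntegral_mono' measurableSet_Ioi htail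
        _ = 1 := by
          rw [← ofReal_integral_eq_lintegral_ofReal (integrableOn_exp_neg_Ioi 0)
            (.of_forall fun x => (Real.exp_pos _).le), integral_exp_neg_Ioi_zero]
          simp
    have hpos : Integrable (fun x => max (l x) 0) ν := hli.pos_part
    have h1 : -Real.log (F m) ≤ 1 := by
      rw [← hlint]
      refine (integral_mono hli hpos fun x => le_max_left _ _).trans ?_
      rw [← ofReal_integral_eq_lintegral_ofReal hpos (.of_forall fun x => le_max_right _ _)] at hle
      simpa using hle
    rw [hFE]
    refine ENNReal.ofReal_le_ofReal ?_
    rw [← Real.exp_log hFm]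
    exact Real.exp_le_exp.2 (by linarith)

/-- Grünbaum's inequality: a halfspace whose bounding hyperplane passes through the centroid
contains at least the fraction `1 / e` of the volume. -/
theorem gruenbaum {E : Type*} [NormedAddCommGroup E] [NormedSpace ℝ E] [FiniteDimensional ℝ E]
    [MeasurableSpace E] [BorelSpace E] {μ : Measure E} [IsFiniteMeasureOnCompacts μ]
    (hμ : PrekopaLeindler μ) {K : Set E} (hK : IsCompact K) (hc : Convex ℝ K) (h0 : μ K ≠ 0)
    (u : E →L[ℝ] ℝ) :
    ENNReal.ofReal (Real.exp (-1)) * μ K ≤ μ (K ∩ {p | u (⨍ y in K, y ∂μ) ≤ u p}) := by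
  have hKm : MeasurableSet K := hK.measurableSet
  have ht : μ K ≠ ∞ := hK.measure_lt_top.ne
  set P : Measure E := (μ K)⁻¹ • μ.restrict K with hP
  have hPp : IsProbabilityMeasure P := ⟨by simp [hP, ENNReal.inv_mul_cancel h0 ht]⟩
  have hum : Measurable u := u.continuous.measurable
  set ν := P.map u with hν
  have hνp : IsProbabilityMeasure ν := isProbabilityMeasure_map hum.aemeasurable
  have hsm : ∀ t, MeasurableSet {p | t ≤ u p} := fun t => hum measurableSet_Ici
  have hν_apply : ∀ t, ν (Set.Ici t) = (μ K)⁻¹ * μ (K ∩ {p | t ≤ u p}) := by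
    intro t
    rw [hν, map_apply hum measurableSet_Ici, hP, Measure.smul_apply, restrict_apply (hum measurableSet_Ici),
      smul_eq_mul, Set.inter_comm]
    rfl
  have hKi : Integrable (fun y => y) P :=
    (continuousOn_id.integrableOn_compact hK).smul_measure (ENNReal.inv_ne_top.2 h0)
  have hmean : ∫ x, x ∂ν = u (⨍ y in K, y ∂μ) := by
    rw [hν, integral_map hum.aemeasurable (by fun_prop), ContinuousLinearMap.integral_comp_comm u hKi,
      setAverage_eq', hP]
  have hνi : Integrable (fun x => x) ν := by
    rw [hν, integrable_map_measure (by fun_prop) hum.aemeasurable]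
    exact u.integrable_comp hKi
  have key := exp_neg_one_le_measure_Ici_mean ν hνi ?_
  · rw [hmean, hν_apply] at key
    calc ENNReal.ofReal (Real.exp (-1)) * μ K
        ≤ (μ K)⁻¹ * μ (K ∩ {p | u (⨍ y in K, y ∂μ) ≤ u p}) * μ K := by gcongr
      _ = μ (K ∩ {p | u (⨍ y in K, y ∂μ) ≤ u p}) * ((μ K)⁻¹ * μ K) := by ring
      _ = _ := by rw [ENNReal.inv_mul_cancel h0 ht, mul_one]
  · intro s t θ h0' h1'
    have hθ : 0 < 1 - θ := by linarith
    have hpl := hμ θ h0' h1' ((K ∩ {p | s ≤ u p}).indicator 1) ((K ∩ {p | t ≤ u p}).indicator 1)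
      ((K ∩ {p | (1 - θ) * s + θ * t ≤ u p}).indicator 1)
      (measurable_one.indicator (hKm.inter (hsm _))) (measurable_one.indicator (hKm.inter (hsm _)))
      (measurable_one.indicator (hKm.inter (hsm _))) ?_
    · rw [lintegral_indicator_one (hKm.inter (hsm _)), lintegral_indicator_one (hKm.inter (hsm _)),
        lintegral_indicator_one (hKm.inter (hsm _))] at hpl
      simp only [hν_apply]
      rw [ENNReal.mul_rpow_of_nonneg _ _ hθ.le, ENNReal.mul_rpow_of_nonneg _ _ h0'.le]
      have e : (μ K)⁻¹ = (μ K)⁻¹ ^ (1 - θ) * (μ K)⁻¹ ^ θ := by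
        rw [← ENNReal.rpow_add _ _ (by simpa using ht) (by simpa using h0)]; simp
      calc _ = (μ K)⁻¹ ^ (1 - θ) * (μ K)⁻¹ ^ θ *
            (μ (K ∩ {p | s ≤ u p}) ^ (1 - θ) * μ (K ∩ {p | t ≤ u p}) ^ θ) := by ring
        _ ≤ _ := by rw [← e]; gcongr
    · intro x y
      by_cases hx : x ∈ K ∩ {p | s ≤ u p}
      · by_cases hy : y ∈ K ∩ {p | t ≤ u p}
        · have : (1 - θ) • x + θ • y ∈ K ∩ {p | (1 - θ) * s + θ * t ≤ u p} := by
            refine ⟨hc hx.1 hy.1 hθ.le h0'.le (by ring), ?_⟩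
            have h1 : s ≤ u x := hx.2
            have h2 : t ≤ u y := hy.2
            simp only [Set.mem_ofPred_eq, map_add, map_smul, smul_eq_mul]
            gcongr
          simp [Set.indicator_of_mem hx, Set.indicator_of_mem hy, Set.indicator_of_mem this]
        · simp [Set.indicator_of_notMem hy, h0']
      · simp [Set.indicator_of_notMem hx, hθ]

end Gruenbaum

/-! ### Mixed-integer volume versus Lebesgue measure -/

section LatticeVolume

/-- The mixed-integer volume of `A ⊆ ℝ^n × ℝ^d`: the sum over `z ∈ ℤ^n` of the `d`-dimensional
Lebesgue measures of the fibres of `A` over `z`. -/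
noncomputable def latticeVol {n d : ℕ} (A : Set ((Fin n → ℝ) × (Fin d → ℝ))) : ℝ≥0∞ :=
  ∑' z : Fin n → ℤ, volume {y : Fin d → ℝ | ((fun i => (z i : ℝ)), y) ∈ A}

lemma lintegral_eq_tsum_unitCube {n : ℕ} (F : (Fin n → ℝ) → ℝ≥0∞) :
    ∫⁻ x, F x = ∑' z : Fin n → ℤ,
      ∫⁻ x in Set.pi Set.univ fun i => Set.Ico (z i : ℝ) (z i + 1), F x := by
  have hU : ⋃ z : Fin n → ℤ, (Set.pi Set.univ fun i => Set.Ico (z i : ℝ) (z i + 1)) = Set.univ := by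
    refine Set.eq_univ_of_forall fun x => Set.mem_iUnion.2 ⟨fun i => ⌊x i⌋, fun i _ => ?_⟩
    exact ⟨Int.floor_le _, Int.lt_floor_add_one _⟩
  rw [← setLIntegral_univ, ← hU]
  refine lintegral_iUnion (fun z => MeasurableSet.univ_pi fun i => measurableSet_Ico) ?_ _
  intro z z' hzz'
  refine Set.disjoint_left.2 fun x hx hx' => hzz' (funext fun i => ?_)
  have h1 := hx i trivial
  have h2 := hx' i trivial
  rw [← Int.floor_eq_iff.2 h1, ← Int.floor_eq_iff.2 h2]

lemma volume_unitCube {n : ℕ} (z : Fin n → ℤ) :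
    volume (Set.pi Set.univ fun i => Set.Ico (z i : ℝ) (z i + 1)) = 1 := by
  rw [Real.volume_pi_Ico]; simp

variable {n d : ℕ} {K : Set ((Fin n → ℝ) × (Fin d → ℝ))} {a : Fin n → ℝ} {r : ℝ}

/-- If the projection of `K` contains a cube of half-side `r`, every `w ∈ [-1, 1]^n` is the
projection of `r⁻¹ q` relative to `r⁻¹ a`, for some `q ∈ K`. -/
lemma exists_mem_of_closedBall_subset (hr : 0 < r) (hK : Metric.closedBall a r ⊆ Prod.fst '' K)
    (w : Fin n → ℝ) (hw : ∀ i, |w i| ≤ 1) : ∃ q ∈ K, r⁻¹ • q.1 = r⁻¹ • a + w := by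
  have : a + r • w ∈ Metric.closedBall a r := by
    rw [Metric.mem_closedBall, dist_eq_norm, add_sub_cancel_left, pi_norm_le_iff_of_nonneg hr.le]
    intro i
    simpa [abs_mul, abs_of_pos hr] using mul_le_of_le_one_right hr.le (hw i)
  obtain ⟨q, hq, hq'⟩ := hK this
  refine ⟨q, hq, ?_⟩
  rw [hq', smul_add, smul_smul, inv_mul_cancel₀ hr.ne', one_smul]

/-- If `A + r⁻¹ K ⊆ D`, then for every `x` in the unit cube at `z` some translate of the fibre of
`A` over `z` lies in the fibre of `D` over `x + r⁻¹ a`. -/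
theorem latticeVol_le_volume (hr : 0 < r) (hK : Metric.closedBall a r ⊆ Prod.fst '' K)
    {A D : Set ((Fin n → ℝ) × (Fin d → ℝ))} (hD : MeasurableSet D)
    (h : ∀ p ∈ A, ∀ q ∈ K, p + r⁻¹ • q ∈ D) : latticeVol A ≤ volume D := by
  rw [volume_eq_prod, prod_apply hD, ← lintegral_add_right_eq_self _ (r⁻¹ • a),
    lintegral_eq_tsum_unitCube]
  refine ENNReal.tsum_le_tsum fun z => ?_
  rw [← mul_one (volume _), ← volume_unitCube z, ← setLIntegral_const]
  refine setLIntegral_mono' (MeasurableSet.univ_pi fun i => measurableSet_Ico) fun x hx => ?_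
  obtain ⟨q, hq, hq'⟩ := exists_mem_of_closedBall_subset hr hK (fun i => x i - z i) fun i => by
    have := hx i trivial
    rw [abs_le]; constructor <;> linarith [this.1, this.2]
  refine le_of_le_of_eq (measure_mono fun y hy => ?_)
    (measure_preimage_add_right volume (r⁻¹ • q.2) _)
  have := h _ hy q hq
  have e : (((fun i => (z i : ℝ)), y) : (Fin n → ℝ) × (Fin d → ℝ)) + r⁻¹ • q
      = (x + r⁻¹ • a, y + r⁻¹ • q.2) := by
    refine Prod.ext ?_ rfl
    change _ + r⁻¹ • q.1 = _
    rw [hq']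
    ext i
    simp only [Pi.add_apply, Pi.smul_apply]
    ring
  rwa [e] at this

/-- If `B + r⁻¹ K ⊆ G`, then for every `x` in the unit cube at `z` some translate of the fibre of
`B` over `x - r⁻¹ a` lies in the fibre of `G` over `z`. -/
theorem volume_le_latticeVol (hr : 0 < r) (hK : Metric.closedBall a r ⊆ Prod.fst '' K)
    {B G : Set ((Fin n → ℝ) × (Fin d → ℝ))} (hB : MeasurableSet B)
    (h : ∀ p ∈ B, ∀ q ∈ K, p + r⁻¹ • q ∈ G) : volume B ≤ latticeVol G := by
  rw [volume_eq_prod, prod_apply hB, ← lintegral_add_right_eq_self _ (-(r⁻¹ • a)),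
    lintegral_eq_tsum_unitCube]
  refine ENNReal.tsum_le_tsum fun z => ?_
  rw [← mul_one (volume {y | _}), ← volume_unitCube z, ← setLIntegral_const]
  refine setLIntegral_mono' (MeasurableSet.univ_pi fun i => measurableSet_Ico) fun x hx => ?_
  obtain ⟨q, hq, hq'⟩ := exists_mem_of_closedBall_subset hr hK (fun i => z i - x i) fun i => by
    have := hx i trivial
    rw [abs_le]; constructor <;> linarith [this.1, this.2]
  refine le_of_le_of_eq (measure_mono fun y hy => ?_)
    (measure_preimage_add_right volume (r⁻¹ • q.2) _)
  have := h _ hy q hq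
  have e : ((x + -(r⁻¹ • a), y) : (Fin n → ℝ) × (Fin d → ℝ)) + r⁻¹ • q
      = ((fun i => (z i : ℝ)), y + r⁻¹ • q.2) := by
    refine Prod.ext ?_ rfl
    change _ + r⁻¹ • q.1 = _
    rw [hq']
    ext i
    simp only [Pi.add_apply, Pi.neg_apply, Pi.smul_apply]
    ring
  rwa [e] at this

instance isAddHaarMeasure_volume_prod :
    (volume : Measure ((Fin n → ℝ) × (Fin d → ℝ))).IsAddHaarMeasure :=
  prod.instIsAddHaarMeasure (volume : Measure (Fin n → ℝ)) (volume : Measure (Fin d → ℝ))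

lemma volume_smul_set {s : ℝ} (hs : 0 ≤ s) (A : Set ((Fin n → ℝ) × (Fin d → ℝ))) :
    volume ((fun p => s • p) '' A) = ENNReal.ofReal (s ^ (n + d)) * volume A := by
  have : volume ((fun p => s • p) '' A) = _ := addHaar_smul volume s A
  rw [this]
  simp [abs_of_nonneg, pow_nonneg hs]

lemma volume_contract_le {s : ℝ} (hs : 0 ≤ s) {A B : Set ((Fin n → ℝ) × (Fin d → ℝ))}
    (v : (Fin n → ℝ) × (Fin d → ℝ)) (h : ∀ p ∈ A, s • p + v ∈ B) :
    ENNReal.ofReal (s ^ (n + d)) * volume A ≤ volume B := by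
  rw [← volume_smul_set hs, ← measure_preimage_add_right volume v B]
  refine measure_mono ?_
  rintro _ ⟨p, hp, rfl⟩
  exact h p hp

/-- Upper bound for the mixed-integer volume of a convex body. -/
theorem latticeVol_le_mul_volume (hr : 0 < r) (hK : Metric.closedBall a r ⊆ Prod.fst '' K)
    (hc : Convex ℝ K) (hKc : IsCompact K) :
    latticeVol K ≤ ENNReal.ofReal ((1 + r⁻¹) ^ (n + d)) * volume K := by
  have hpos : 0 < 1 + r⁻¹ := by positivity
  rw [← volume_smul_set hpos.le]
  refine latticeVol_le_volume hr hK (hKc.image (continuous_const_smul _)).measurableSet ?_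
  intro p hp q hq
  refine ⟨(1 + r⁻¹)⁻¹ • p + ((1 + r⁻¹)⁻¹ * r⁻¹) • q,
    hc hp hq (by positivity) (by positivity) (by field_simp), ?_⟩
  simp only [smul_add, smul_smul]
  rw [mul_inv_cancel₀ hpos.ne', ← mul_assoc, mul_inv_cancel₀ hpos.ne', one_mul, one_smul]

/-- Lower bound for the mixed-integer volume of the part of a convex body satisfying `u ≥ b`, in
terms of the part satisfying `u ≥ b'`. The hypothesis says that a convex combination of a point of
the latter part with any point of `K`, with weights `1 - r⁻¹` and `r⁻¹`, satisfies `u ≥ b`. -/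
theorem mul_volume_le_latticeVol (hr : 1 ≤ r) (hK : Metric.closedBall a r ⊆ Prod.fst '' K)
    (hc : Convex ℝ K) (hKc : IsCompact K) (u : ((Fin n → ℝ) × (Fin d → ℝ)) →L[ℝ] ℝ) {b b' : ℝ}
    (hb : ∀ q ∈ K, b ≤ (1 - r⁻¹) * b' + r⁻¹ * u q) :
    ENNReal.ofReal ((1 - r⁻¹) ^ (n + d)) * volume (K ∩ {p | b' ≤ u p})
      ≤ latticeVol (K ∩ {p | b ≤ u p}) := by
  have hr1 : r⁻¹ ≤ 1 := inv_le_one_of_one_le₀ hr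
  have hs : 0 ≤ 1 - r⁻¹ := by linarith
  have hr0 : 0 < r := by linarith
  rw [← volume_smul_set hs]
  refine volume_le_latticeVol hr0 hK ?_ ?_
  · refine IsCompact.measurableSet (IsCompact.image (hKc.inter_right ?_) (continuous_const_smul _))
    exact isClosed_le continuous_const u.continuous
  · rintro _ ⟨p, hp, rfl⟩ q hq
    refine ⟨hc hp.1 hq hs (by positivity) (by ring), ?_⟩
    have h1 : b' ≤ u p := hp.2
    simp only [Set.mem_ofPred_eq, map_add, map_smul, smul_eq_mul]
    refine (hb q hq).trans ?_
    gcongr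

end LatticeVolume

/-! ### A deep mixed-integer point -/

section DeepPoint

lemma exp_neg_one_le_half : Real.exp (-1) ≤ 1 / 2 := by
  rw [Real.exp_neg, one_div]
  exact inv_anti₀ two_pos (by linarith [Real.add_one_le_exp (1 : ℝ)])

/-- The arithmetic that converts the Lebesgue estimates into the fraction `1 / e - 2 N s`. -/
lemma sub_mul_pow_le {N : ℕ} {s : ℝ} (hs : 0 ≤ s) (hs1 : s ≤ 1) (hN : 2 * (N * s) < Real.exp (-1)) :
    (Real.exp (-1) - 2 * (N * s)) * (1 + s) ^ N
      ≤ (1 - s) ^ N * Real.exp (-1) - (1 - (1 - s) ^ N) := by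
  set ε := Real.exp (-1) with hε
  have h1 : ε ≤ 1 / 2 := exp_neg_one_le_half
  have h0 : 0 < ε := Real.exp_pos _
  have hτ : 0 ≤ N * s := by positivity
  have hb : 1 - N * s ≤ (1 - s) ^ N := by
    have := one_add_mul_le_pow (a := -s) (by linarith) N
    rw [← sub_eq_add_neg] at this
    linarith
  have hinv : (1 + s) ^ N * (1 - s) ^ N ≤ 1 := by
    rw [← mul_pow]
    exact pow_le_one₀ (mul_nonneg (by linarith) (by linarith)) (by nlinarith)
  have hp : 0 < (1 + s) ^ N := by positivity
  have hup : (1 + s) ^ N * (1 - N * s) ≤ 1 :=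
    (mul_le_mul_of_nonneg_left hb hp.le).trans hinv
  have hτ1 : 0 < 1 - N * s := by linarith
  set τ := N * s with hτd
  set c := (1 - s) ^ N
  set A := (1 + s) ^ N
  have h2 : ε - 2 * τ ≤ (ε - (1 + ε) * τ) * (1 - τ) := by
    linarith [mul_nonneg hτ (by linarith : 0 ≤ 1 - 2 * ε),
      mul_nonneg (mul_nonneg hτ hτ) (by linarith : 0 ≤ 1 + ε)]
  have h4 : 0 ≤ ε - (1 + ε) * τ := by nlinarith
  calc (ε - 2 * τ) * A ≤ (ε - (1 + ε) * τ) * (1 - τ) * A := by gcongr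
    _ = (ε - (1 + ε) * τ) * (A * (1 - τ)) := by ring
    _ ≤ (ε - (1 + ε) * τ) * 1 := by gcongr
    _ ≤ c * ε - (1 - c) := by nlinarith

variable {n d : ℕ} {K : Set ((Fin n → ℝ) × (Fin d → ℝ))} {a : Fin n → ℝ} {r : ℝ}

/-- A point of `K` can be moved to a nearby point with integral first coordinates: `q` is chosen so
that its projection corrects `(1 - r⁻¹) c + r⁻¹ a` to the coordinatewise integer part. -/
lemma exists_lattice_point_combination (hr : 1 ≤ r)
    (hK : Metric.closedBall a r ⊆ Prod.fst '' K) (hc : Convex ℝ K)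
    {c : (Fin n → ℝ) × (Fin d → ℝ)} (hcK : c ∈ K) :
    ∃ q ∈ K, (1 - r⁻¹) • c + r⁻¹ • q ∈ K ∧
      ∃ z : Fin n → ℤ, ((1 - r⁻¹) • c + r⁻¹ • q).1 = fun i => (z i : ℝ) := by
  have hr0 : 0 < r := by linarith
  have hr1 : r⁻¹ ≤ 1 := inv_le_one_of_one_le₀ hr
  set p : Fin n → ℝ := (1 - r⁻¹) • c.1 + r⁻¹ • a with hp
  obtain ⟨q, hq, hq'⟩ := exists_mem_of_closedBall_subset hr0 hK (fun i => (⌊p i⌋ : ℝ) - p i)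
    fun i => by
      rw [abs_le]
      constructor <;> linarith [Int.floor_le (p i), Int.lt_floor_add_one (p i)]
  refine ⟨q, hq, hc hcK hq (by linarith) (by positivity) (by ring), fun i => ⌊p i⌋, ?_⟩
  change (1 - r⁻¹) • c.1 + r⁻¹ • q.1 = _
  rw [hq', ← add_assoc, ← hp]
  ext i
  simp

/-- The mixed-integer Grünbaum inequality for a convex body whose projection contains a cube of
half-side `r`. The point is a convex combination `(1 - r⁻¹) c + r⁻¹ q` of the centroid `c` and a
point `q` that makes its first coordinates integral. -/
theorem exists_deep_lattice_point (hK : Metric.closedBall a r ⊆ Prod.fst '' K)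
    (hc : Convex ℝ K) (hKc : IsCompact K) (h0 : volume K ≠ 0) (hr : 1 < r)
    (hN : 2 * ((n + d : ℕ) * r⁻¹) < Real.exp (-1)) :
    ∃ x ∈ K, (∃ z : Fin n → ℤ, x.1 = fun i => (z i : ℝ)) ∧
      ∀ (u : ((Fin n → ℝ) × (Fin d → ℝ)) →L[ℝ] ℝ) (b : ℝ), b ≤ u x →
        ENNReal.ofReal (Real.exp (-1) - 2 * ((n + d : ℕ) * r⁻¹)) * latticeVol K
          ≤ latticeVol (K ∩ {p | b ≤ u p}) := by
  have hr0 : 0 < r := by linarith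
  have hs0 : 0 < r⁻¹ := by positivity
  have hs1 : r⁻¹ < 1 := inv_lt_one_of_one_lt₀ hr
  have hs1' : 0 < 1 - r⁻¹ := by linarith
  have hKt : volume K ≠ ∞ := hKc.measure_lt_top.ne
  have hPL : PrekopaLeindler (volume : Measure ((Fin n → ℝ) × (Fin d → ℝ))) :=
    (prekopaLeindler_pi n).prod (prekopaLeindler_pi d)
  set c := ⨍ y in K, y ∂volume with hcdef
  have hcK : c ∈ K := hc.set_average_mem hKc.isClosed h0 hKt
    (ae_restrict_mem hKc.measurableSet) (continuousOn_id.integrableOn_compact hKc)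
  obtain ⟨q, hq, hx, hz⟩ := exists_lattice_point_combination hr.le hK hc hcK
  refine ⟨_, hx, hz, fun u b hb => ?_⟩
  have hne : K.Nonempty := ⟨c, hcK⟩
  obtain ⟨m, hmK, hm⟩ := hKc.exists_isMaxOn hne u.continuous.continuousOn
  obtain ⟨m', hmK', hm'⟩ := hKc.exists_isMinOn hne u.continuous.continuousOn
  have hmle : ∀ p ∈ K, u p ≤ u m := fun p hp => hm hp
  have hmge : ∀ p ∈ K, u m' ≤ u p := fun p hp => hm' hp
  simp only [map_add, map_smul, smul_eq_mul] at hb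
  set s := r⁻¹ with hs
  set b' := (b - s * u m') / (1 - s) with hb'
  have hbb' : (1 - s) * b' = b - s * u m' := by rw [hb']; field_simp
  -- Contracting towards a maximum point of `u` carries `{u ≥ u c}` into `{u ≥ b}`.
  have step1 : ENNReal.ofReal ((1 - s) ^ (n + d)) * volume (K ∩ {p | u c ≤ u p})
      ≤ volume (K ∩ {p | b ≤ u p}) := by
    refine volume_contract_le hs1'.le (s • m) fun p hp => ⟨?_, ?_⟩
    · exact hc hp.1 hmK hs1'.le hs0.le (by ring)
    · have h1 : u c ≤ u p := hp.2
      simp only [Set.mem_ofPred_eq, map_add, map_smul, smul_eq_mul]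
      refine hb.trans ?_
      have := hmle q hq
      gcongr
  -- Contracting towards a minimum point of `u` carries `{u < b'}` into `{u < b}`.
  have step2 : ENNReal.ofReal ((1 - s) ^ (n + d)) * volume (K \ {p | b' ≤ u p})
      ≤ volume (K \ {p | b ≤ u p}) := by
    refine volume_contract_le hs1'.le (s • m') fun p hp => ⟨?_, ?_⟩
    · exact hc hp.1 hmK' hs1'.le hs0.le (by ring)
    · have h1 : u p < b' := not_le.1 hp.2
      simp only [Set.mem_ofPred_eq, map_add, map_smul, smul_eq_mul, not_le]
      have := mul_lt_mul_of_pos_left h1 hs1'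
      linarith
  -- The value `b'` is the least one with `(1 - s) b' + s (u q') ≥ b` for all `q' ∈ K`.
  have step3 : ENNReal.ofReal ((1 - s) ^ (n + d)) * volume (K ∩ {p | b' ≤ u p})
      ≤ latticeVol (K ∩ {p | b ≤ u p}) := by
    refine mul_volume_le_latticeVol hr.le hK hc hKc u fun q' hq' => ?_
    have := mul_le_mul_of_nonneg_left (hmge q' hq') hs0.le
    linarith
  have step4 := gruenbaum hPL hKc hc h0 u
  rw [← hcdef] at step4
  have hmeas : ∀ t, MeasurableSet {p | t ≤ u p} := fun t => u.continuous.measurable measurableSet_Ici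
  have hsum : ∀ t, volume.real (K ∩ {p | t ≤ u p}) + volume.real (K \ {p | t ≤ u p})
      = volume.real K := fun t => measureReal_inter_add_sdiff (hmeas t) hKt
  have fin1 : ∀ A : Set ((Fin n → ℝ) × (Fin d → ℝ)), volume (K ∩ A) ≠ ∞ :=
    fun A => ne_top_of_le_ne_top hKt (measure_mono Set.inter_subset_left)
  have fin2 : ∀ A : Set ((Fin n → ℝ) × (Fin d → ℝ)), volume (K \ A) ≠ ∞ :=
    fun A => ne_top_of_le_ne_top hKt (measure_mono Set.sdiff_subset)
  have hpow : 0 ≤ (1 - s) ^ (n + d) := pow_nonneg hs1'.le _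
  have r1 := ENNReal.toReal_mono (fin1 _) step1
  have r2 := ENNReal.toReal_mono (fin2 _) step2
  have r4 := ENNReal.toReal_mono (fin1 _) step4
  rw [ENNReal.toReal_mul, ENNReal.toReal_ofReal hpow] at r1 r2
  rw [ENNReal.toReal_mul, ENNReal.toReal_ofReal (Real.exp_pos _).le] at r4
  simp only [← measureReal_def] at r1 r2 r4
  have e1 := hsum b
  have e2 := hsum b'
  set w := (1 - s) ^ (n + d) with hw
  have main : (Real.exp (-1) - 2 * ((n + d : ℕ) * s)) * (1 + s) ^ (n + d) * volume.real K
      ≤ w * volume.real (K ∩ {p | b' ≤ u p}) := by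
    have h1 := mul_le_mul_of_nonneg_right (sub_mul_pow_le hs0.le hs1.le hN)
      (measureReal_nonneg (μ := volume) (s := K))
    have h2 := mul_le_mul_of_nonneg_left r4 hpow
    have h3 : w * volume.real (K \ {p | b' ≤ u p})
      = w * volume.real K - w * volume.real (K ∩ {p | b' ≤ u p}) := by rw [← e2]; ring
    rw [← hw] at h1
    linarith
  refine le_trans ?_ step3
  have hcoef : 0 ≤ Real.exp (-1) - 2 * ((n + d : ℕ) * s) := by linarith
  calc ENNReal.ofReal (Real.exp (-1) - 2 * ((n + d : ℕ) * s)) * latticeVol K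
      ≤ ENNReal.ofReal (Real.exp (-1) - 2 * ((n + d : ℕ) * s)) *
        (ENNReal.ofReal ((1 + s) ^ (n + d)) * volume K) := by
        gcongr; exact latticeVol_le_mul_volume hr0 hK hc hKc
    _ = ENNReal.ofReal ((Real.exp (-1) - 2 * ((n + d : ℕ) * s)) * (1 + s) ^ (n + d)
          * volume.real K) := by
        rw [ENNReal.ofReal_mul (by positivity), ENNReal.ofReal_mul hcoef, measureReal_def,
          ENNReal.ofReal_toReal hKt, mul_assoc]
    _ ≤ ENNReal.ofReal (w * volume.real (K ∩ {p | b' ≤ u p})) := ENNReal.ofReal_le_ofReal main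
    _ = _ := by
        rw [ENNReal.ofReal_mul hpow, measureReal_def, ENNReal.ofReal_toReal (fin1 _)]

/-- The mixed-integer volume of a convex body is finite and positive. -/
theorem latticeVol_ne_zero_ne_top (hK : Metric.closedBall a r ⊆ Prod.fst '' K)
    (hc : Convex ℝ K) (hKc : IsCompact K) (h0 : volume K ≠ 0) (hr : 1 < r) :
    latticeVol K ≠ 0 ∧ latticeVol K ≠ ∞ := by
  have hs1 : 0 < 1 - r⁻¹ := by linarith [inv_lt_one_of_one_lt₀ hr]
  constructor
  · have := mul_volume_le_latticeVol hr.le hK hc hKc 0 (b := 0) (b' := 0) (by simp)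
    simp only [zero_apply, le_refl, Set.ofPred_true, Set.inter_univ] at this
    refine fun h => ?_
    rw [h, le_zero_iff, mul_eq_zero] at this
    rcases this with h' | h'
    · exact absurd (ENNReal.ofReal_eq_zero.1 h') (not_le.2 (pow_pos hs1 _))
    · exact h0 h'
  · exact ne_top_of_le_ne_top (ENNReal.mul_ne_top ENNReal.ofReal_ne_top hKc.measure_lt_top.ne)
      (latticeVol_le_mul_volume (by linarith) hK hc hKc)

end DeepPoint

/-! ### Hausdorff measure of mixed-integer sets -/

section Hausdorff

variable {n d : ℕ}

/-- The identification of `Space n d` with `ℝ^n × ℝ^d` (with the sup norm). -/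
noncomputable def toProd (n d : ℕ) : Space n d ≃L[ℝ] (Fin n → ℝ) × (Fin d → ℝ) :=
  (PiLp.continuousLinearEquiv 2 ℝ (fun _ : Fin n ⊕ Fin d => ℝ)).trans
    (ContinuousLinearEquiv.sumPiEquivProdPi ℝ (Fin n) (Fin d) (fun _ => ℝ))

/-- The embedding of `ℝ^d` onto the fibre of `ℝ^n × ℝ^d` over `z`. -/
noncomputable def fibreEmbedding (z : Fin n → ℝ) (y : EuclideanSpace ℝ (Fin d)) : Space n d :=
  WithLp.toLp 2 (Sum.elim z y)

lemma isometry_fibreEmbedding (z : Fin n → ℝ) :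
    Isometry (fibreEmbedding (d := d) z) := by
  refine Isometry.of_dist_eq fun y y' => ?_
  rw [EuclideanSpace.dist_eq, EuclideanSpace.dist_eq, Fintype.sum_sum_type]
  simp [fibreEmbedding]

lemma toProd_fibreEmbedding (z : Fin n → ℝ) (y : EuclideanSpace ℝ (Fin d)) :
    toProd n d (fibreEmbedding z y) = (z, y.ofLp) := rfl

lemma exists_hausdorffMeasure_eq_smul_volume (d : ℕ) : ∃ c : ℝ≥0∞, c ≠ 0 ∧ c ≠ ∞ ∧
    (μH[d] : Measure (EuclideanSpace ℝ (Fin d))) = c • volume :=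
  ⟨addHaarScalarFactor (μH[d] : Measure (EuclideanSpace ℝ (Fin d))) volume,
    ENNReal.coe_ne_zero.2 (addHaarScalarFactor_pos_of_isAddHaarMeasure _ _).ne', ENNReal.coe_ne_top,
    isAddLeftInvariant_eq_smul _ _⟩

/-- The numerical factor in `vol d` is positive and finite. -/
lemma exists_vol_eq_smul_hausdorffMeasure (ι : Type) [Fintype ι] (d : ℕ) :
    ∃ c : ℝ≥0∞, c ≠ 0 ∧ c ≠ ∞ ∧
      (vol (d : ℝ) : Measure (EuclideanSpace ℝ ι)) = c • μH[(d : ℝ)] := by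
  refine ⟨_, ?_, ENNReal.ofReal_ne_top, rfl⟩
  have h1 : 0 < Real.Gamma ((d : ℝ) / 2 + 1) := Real.Gamma_pos_of_pos (by positivity)
  have h2 : 0 < Real.pi ^ ((d : ℝ) / 2) := Real.rpow_pos_of_pos Real.pi_pos _
  rw [Ne, ENNReal.ofReal_eq_zero, not_le]
  positivity

/-- On mixed-integer sets, `vol d` is the sum of the Lebesgue measures of the fibres up to a
constant factor, which drops out of all ratios. -/
theorem exists_vol_inter_lattice_eq (n d : ℕ) : ∃ c : ℝ≥0∞, c ≠ 0 ∧ c ≠ ∞ ∧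
    ∀ A : Set (Space n d), MeasurableSet A →
      vol (d : ℝ) (A ∩ lattice n d) = c * latticeVol (toProd n d '' A) := by
  obtain ⟨c₁, h₁, h₁', e₁⟩ := exists_hausdorffMeasure_eq_smul_volume d
  obtain ⟨c₂, h₂, h₂', e₂⟩ := exists_vol_eq_smul_hausdorffMeasure (Fin n ⊕ Fin d) d
  refine ⟨c₂ * c₁, mul_ne_zero h₂ h₁, ENNReal.mul_ne_top h₂' h₁', fun A hA => ?_⟩
  have hU : A ∩ lattice n d = ⋃ z : Fin n → ℤ, A ∩ {x | ∀ i, x (Sum.inl i) = (z i : ℝ)} := by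
    ext x
    simp only [lattice, Set.mem_inter_iff, Set.mem_ofPred_eq, Set.mem_iUnion, exists_and_left,
      Classical.skolem]
  have hm : ∀ z : Fin n → ℤ, MeasurableSet (A ∩ {x : Space n d | ∀ i, x (Sum.inl i) = (z i : ℝ)}) := by
    intro z
    refine hA.inter (IsClosed.measurableSet ?_)
    simp only [Set.ofPred_forall]
    exact isClosed_iInter fun i => isClosed_eq (by fun_prop) continuous_const
  have hd : Pairwise (Function.onFun Disjoint
      fun z : Fin n → ℤ => A ∩ {x : Space n d | ∀ i, x (Sum.inl i) = (z i : ℝ)}) := by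
    intro z z' hzz'
    refine Set.disjoint_left.2 fun x hx hx' => hzz' (funext fun i => ?_)
    exact Int.cast_injective (α := ℝ) ((hx.2 i).symm.trans (hx'.2 i))
  have hfib : ∀ z : Fin n → ℤ,
      A ∩ {x : Space n d | ∀ i, x (Sum.inl i) = (z i : ℝ)}
        = fibreEmbedding (fun i => (z i : ℝ)) '' (fibreEmbedding (fun i => (z i : ℝ)) ⁻¹' A) := by
    intro z
    rw [Set.image_preimage_eq_inter_range]
    congr 1
    ext x
    constructor
    · intro hx
      refine ⟨WithLp.toLp 2 fun j => x (Sum.inr j), ?_⟩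
      ext i
      rcases i with i | j
      · exact (hx i).symm
      · rfl
    · rintro ⟨y, rfl⟩ i
      rfl
  have hpre : ∀ z : Fin n → ℝ, (fibreEmbedding z ⁻¹' A : Set (EuclideanSpace ℝ (Fin d)))
      = (WithLp.ofLp) ⁻¹' {y : Fin d → ℝ | (z, y) ∈ toProd n d '' A} := by
    intro z
    ext y
    simp only [Set.mem_preimage, Set.mem_ofPred_eq]
    rw [← toProd_fibreEmbedding]
    exact ((toProd n d).injective.mem_set_image).symm
  have hmp : ∀ z : Fin n → ℝ, MeasurableSet {y : Fin d → ℝ | (z, y) ∈ toProd n d '' A} := by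
    intro z
    refine measurable_prodMk_left
      ((toProd n d).toHomeomorph.measurableEmbedding.measurableSet_image.2 hA)
  rw [hU, measure_iUnion hd hm, latticeVol, ← ENNReal.tsum_mul_left]
  refine tsum_congr fun z => ?_
  rw [e₂, Measure.smul_apply, hfib, (isometry_fibreEmbedding _).hausdorffMeasure_image
    (Or.inl (Nat.cast_nonneg d)), e₁, Measure.smul_apply, hpre,
    (PiLp.volume_preserving_ofLp (Fin d)).measure_preimage (hmp _).nullMeasurableSet,
    smul_eq_mul, smul_eq_mul, mul_assoc]

lemma closedBall_subset_fst_image {C : Set (Space n d)} {a : EuclideanSpace ℝ (Fin n)} {k : ℝ}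
    (hn : 1 ≤ n) (hk : 0 < k) (h : Metric.closedBall a k ⊆ proj '' C) :
    Metric.closedBall a.ofLp (k / √n) ⊆ Prod.fst '' (toProd n d '' C) := by
  have hn' : 0 < √(n : ℝ) := Real.sqrt_pos.2 (by exact_mod_cast hn)
  have hr : 0 ≤ k / √n := by positivity
  intro v hv
  have hv' : WithLp.toLp 2 v ∈ Metric.closedBall a k := by
    rw [mem_closedBall_iff_norm, pi_norm_le_iff_of_nonneg hr] at hv
    rw [mem_closedBall_iff_norm, EuclideanSpace.norm_eq, ← Real.sqrt_sq hk.le]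
    refine Real.sqrt_le_sqrt ?_
    calc ∑ i, ‖(WithLp.toLp 2 v - a) i‖ ^ 2 ≤ ∑ i : Fin n, (k / √n) ^ 2 := by
          refine Finset.sum_le_sum fun i _ => ?_
          exact pow_le_pow_left₀ (norm_nonneg _) (hv i) 2
      _ = k ^ 2 := by
          rw [Finset.sum_const, Finset.card_univ, Fintype.card_fin, nsmul_eq_mul, div_pow,
            Real.sq_sqrt (by positivity)]
          have : (n : ℝ) ≠ 0 := by positivity
          field_simp
  obtain ⟨x, hx, hxv⟩ := h hv'
  refine ⟨_, ⟨x, hx, rfl⟩, ?_⟩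
  ext i
  exact congrFun (congrArg WithLp.ofLp hxv) i

/-- The mixed-integer Grünbaum inequality, with an explicit loss of order `(n + d) √n / k`. -/
theorem exists_deep_point {C : Set (Space n d)} (hC : IsConvexBody C) (hn : 1 ≤ n) (hd : 1 ≤ d)
    {a : EuclideanSpace ℝ (Fin n)} {k : ℝ} (hk : 0 < k) (h : Metric.closedBall a k ⊆ proj '' C)
    (hN : 2 * ((n + d : ℕ) * (√n / k)) < Real.exp (-1)) :
    (∃ x ∈ C ∩ lattice n d, ∀ (u : Space n d) (b : ℝ), b ≤ inner ℝ u x →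
      ENNReal.ofReal (Real.exp (-1) - 2 * ((n + d : ℕ) * (√n / k)))
          * vol (d : ℝ) (C ∩ lattice n d)
        ≤ vol (d : ℝ) ((C ∩ lattice n d) ∩ {y | b ≤ inner ℝ u y})) ∧
    vol (d : ℝ) (C ∩ lattice n d) ≠ 0 ∧ vol (d : ℝ) (C ∩ lattice n d) ≠ ∞ := by
  have hn' : 0 < √(n : ℝ) := Real.sqrt_pos.2 (by exact_mod_cast hn)
  have hr0 : 0 < k / √n := by positivity
  have hinv : (k / √n)⁻¹ = √n / k := inv_div _ _
  have hr : 1 < k / √n := by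
    rw [← inv_lt_one₀ hr0, hinv]
    have h1 := hN.trans_le exp_neg_one_le_half
    have h2 : (2 : ℝ) ≤ (n + d : ℕ) := by exact_mod_cast (by omega : 2 ≤ n + d)
    have h3 : 0 < √n / k := by positivity
    nlinarith
  have hK := closedBall_subset_fst_image hn hk h
  have hKc : IsCompact (toProd n d '' C) := hC.isCompact.image (toProd n d).continuous
  have hc : Convex ℝ (toProd n d '' C) := hC.convex.linear_image (toProd n d).toLinearMap
  have h0 : volume (toProd n d '' C) ≠ 0 := by
    obtain ⟨x, hx⟩ := hC.nonempty_interior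
    have ho : IsOpen (toProd n d '' interior C) :=
      (toProd n d).toHomeomorph.isOpenMap _ isOpen_interior
    refine ((ho.measure_pos volume ⟨_, x, hx, rfl⟩).trans_le
      (measure_mono (Set.image_mono interior_subset))).ne'
  obtain ⟨c, hc0, hct, hvol⟩ := exists_vol_inter_lattice_eq n d
  have hCm := hC.isCompact.measurableSet
  obtain ⟨hl0, hlt⟩ := latticeVol_ne_zero_ne_top hK hc hKc h0 hr
  rw [hvol C hCm]
  refine ⟨?_, mul_ne_zero hc0 hl0, ENNReal.mul_ne_top hct hlt⟩
  rw [← hinv] at hN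
  obtain ⟨_, ⟨x, hx, rfl⟩, ⟨z, hz⟩, hdeep⟩ := exists_deep_lattice_point hK hc hKc h0 hr hN
  rw [hinv] at hdeep
  refine ⟨x, ⟨hx, fun i => ⟨z i, congrFun hz i⟩⟩, fun u b hb => ?_⟩
  have key := hdeep ((innerSL ℝ u).comp (toProd n d).symm.toContinuousLinearMap) b (by simpa using hb)
  have hset : (C ∩ lattice n d) ∩ {y | b ≤ inner ℝ u y}
      = (C ∩ {y | b ≤ inner ℝ u y}) ∩ lattice n d := Set.inter_right_comm _ _ _
  have hHm : MeasurableSet {y : Space n d | b ≤ inner ℝ u y} :=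
    (isClosed_le continuous_const (by fun_prop)).measurableSet
  have himg : toProd n d '' (C ∩ {y | b ≤ inner ℝ u y}) = toProd n d '' C ∩
      {p | b ≤ ((innerSL ℝ u).comp (toProd n d).symm.toContinuousLinearMap) p} := by
    rw [Set.image_inter (toProd n d).injective]
    congr 1
    ext p
    rw [← (toProd n d).apply_symm_apply p, (toProd n d).injective.mem_set_image]
    simp
  rw [hset, hvol _ (hCm.inter hHm), himg, mul_left_comm]
  gcongr

/-- A set of positive and finite `d`-dimensional volume has dimension `d`. -/
lemma dimH_eq_of_vol {ι : Type} [Fintype ι] {d : ℕ} {S : Set (EuclideanSpace ℝ ι)}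
    (h0 : vol (d : ℝ) S ≠ 0) (ht : vol (d : ℝ) S ≠ ∞) : dimH S = d := by
  obtain ⟨c, hc0, -, hc⟩ := exists_vol_eq_smul_hausdorffMeasure ι d
  rw [hc, Measure.smul_apply, smul_eq_mul] at h0 ht
  have h := dimH_of_hausdorffMeasure_ne_zero_ne_top (s := S) (d := (d : NNReal))
    (by simpa using right_ne_zero_of_mul h0)
    (by
      intro h
      rw [NNReal.coe_natCast] at h
      exact ht (by rw [h, ENNReal.mul_top hc0]))
  simpa using h

/-- A point all of whose halfspaces have relative volume at least `c` bounds the Oertel radius. -/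
lemma le_oertelRadius {ι : Type} [Fintype ι] {d : ℕ} {S : Set (EuclideanSpace ℝ ι)}
    (h0 : vol (d : ℝ) S ≠ 0) (ht : vol (d : ℝ) S ≠ ∞) {c : ℝ≥0∞} {x : EuclideanSpace ℝ ι}
    (hx : x ∈ S) (h : ∀ u : EuclideanSpace ℝ ι,
      c * vol (d : ℝ) S ≤ vol (d : ℝ) (S ∩ {y | inner ℝ u x ≤ inner ℝ u y})) :
    c ≤ oertelRadius S := by
  unfold oertelRadius
  rw [dimH_eq_of_vol h0 ht, ENNReal.toReal_natCast]
  refine le_iSup₂_of_le x hx (le_iInf₂ fun u _ => ?_)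
  rw [ENNReal.le_div_iff_mul_le (Or.inl h0) (Or.inl ht)]
  convert! h u using 2
  ext y
  simp [halfspaceAt, inner_sub_right, and_comm]

/-! ### Numerical estimates -/

/-- The loss `2 (n + d) √n / k` is quadratically smaller than `d n^(3/4) / k^(1/2)`. -/
lemma loss_le (hn : 1 ≤ n) (hd : 1 ≤ d) {k : ℝ} (hk : 0 < k) :
    2 * ((n + d : ℕ) * (√n / k)) ≤ 4 * ((d : ℝ) ^ 2 * (n : ℝ) ^ (3 / 2 : ℝ) / k) := by
  have hn1 : (1 : ℝ) ≤ n := by exact_mod_cast hn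
  have hd1 : (1 : ℝ) ≤ d := by exact_mod_cast hd
  have e : (n : ℝ) ^ (3 / 2 : ℝ) = n * √n := by
    rw [Real.sqrt_eq_rpow, ← Real.rpow_one_add' (by positivity) (by norm_num)]
    norm_num
  have h1 : ((n + d : ℕ) : ℝ) ≤ 2 * ((d : ℝ) ^ 2 * n) := by
    push_cast
    nlinarith [mul_nonneg (sub_nonneg.2 hn1) (sub_nonneg.2 hd1), mul_nonneg (sub_nonneg.2 hd1)
      (by positivity : (0 : ℝ) ≤ d * n)]
  calc 2 * ((n + d : ℕ) * (√n / k)) ≤ 2 * (2 * ((d : ℝ) ^ 2 * n) * (√n / k)) := by gcongr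
    _ = _ := by rw [e]; ring

lemma sq_loss (k : ℝ) (hk : 0 < k) :
    ((d : ℝ) * (n : ℝ) ^ (3 / 4 : ℝ) / k ^ (1 / 2 : ℝ)) ^ 2
      = (d : ℝ) ^ 2 * (n : ℝ) ^ (3 / 2 : ℝ) / k := by
  rw [div_pow, mul_pow, ← Real.rpow_natCast ((n : ℝ) ^ (3 / 4 : ℝ)), ← Real.rpow_mul (by positivity),
    ← Real.rpow_natCast (k ^ (1 / 2 : ℝ)), ← Real.rpow_mul hk.le]
  norm_num

lemma div_succ_pow_le_half (hd : 1 ≤ d) : ((d : ℝ) / (d + 1)) ^ d ≤ 1 / 2 := by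
  have hd0 : (0 : ℝ) < d := by exact_mod_cast hd
  have h := one_add_mul_le_pow (a := 1 / (d : ℝ)) (by have : 0 < 1 / (d : ℝ) := by positivity
                                                      linarith) d
  rw [mul_one_div_cancel hd0.ne'] at h
  have e : (d : ℝ) / (d + 1) = (1 + 1 / (d : ℝ))⁻¹ := by field_simp
  have h2 : (2 : ℝ) ≤ (1 + 1 / (d : ℝ)) ^ d := by linarith
  rw [e, inv_pow, one_div (2 : ℝ)]
  exact inv_anti₀ (by norm_num) h2

end Hausdorff

end MixedInteger

theorem mainTheorem1 :
    (∀ (n d : ℕ), 1 ≤ n → 1 ≤ d →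
      ∀ C : Set (MixedInteger.Space n d), MixedInteger.IsConvexBody C →
      ∀ (a : EuclideanSpace ℝ (Fin n)) (k : ℝ), 0 < k →
        Metric.closedBall a k ⊆ MixedInteger.proj '' C →
        ((C ∩ MixedInteger.lattice n d).Nonempty ∨
          0 < 1 / Real.exp 1 - 11 * ((d : ℝ) * (n : ℝ) ^ (3 / 4 : ℝ) / k ^ (1 / 2 : ℝ))) →
        ∃ x ∈ C ∩ MixedInteger.lattice n d,
          ∀ H : Set (MixedInteger.Space n d), MixedInteger.IsHalfspace H → x ∈ H →
            ENNReal.ofReal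
                (1 / Real.exp 1 - 11 * ((d : ℝ) * (n : ℝ) ^ (3 / 4 : ℝ) / k ^ (1 / 2 : ℝ)))
                * MixedInteger.vol (d : ℝ) (C ∩ MixedInteger.lattice n d)
              ≤ MixedInteger.vol (d : ℝ) ((C ∩ MixedInteger.lattice n d) ∩ H)) ∧
    (∃ α : ℝ, 0 < α ∧
      ∀ (n d : ℕ), 1 ≤ n → 1 ≤ d →
      ∀ C : Set (MixedInteger.Space n d), MixedInteger.IsConvexBody C →
      ∀ (a : EuclideanSpace ℝ (Fin n)) (k : ℝ),
        Metric.closedBall a k ⊆ MixedInteger.proj '' C →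
        α * (d : ℝ) ^ 2 * (n : ℝ) ^ (3 / 2 : ℝ) ≤ k →
        ENNReal.ofReal (1 / 2 ^ n * ((d : ℝ) / ((d : ℝ) + 1)) ^ d)
            ≤ MixedInteger.oertelRadius (C ∩ MixedInteger.lattice n d) ∧
          ENNReal.ofReal (1 / 2 ^ n * (1 / Real.exp 1))
            ≤ MixedInteger.oertelRadius (C ∩ MixedInteger.lattice n d)) := by
  constructor
  · intro n d hn hd C hC a k hk h hS
    set t : ℝ := (d : ℝ) * (n : ℝ) ^ (3 / 4 : ℝ) / k ^ (1 / 2 : ℝ) with ht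
    have ht0 : 0 ≤ t := by positivity
    have he : 1 / Real.exp 1 = Real.exp (-1) := by rw [Real.exp_neg, one_div]
    rcases lt_or_ge 0 (1 / Real.exp 1 - 11 * t) with hpos | hneg
    · have hhalf := MixedInteger.exp_neg_one_le_half
      have hloss := MixedInteger.loss_le hn hd hk
      rw [← MixedInteger.sq_loss k hk, ← ht] at hloss
      have hle : 2 * (((n + d : ℕ) : ℝ) * (√n / k)) ≤ 11 * t := by
        refine hloss.trans ?_
        nlinarith
      obtain ⟨⟨x, hx, hdeep⟩, -, -⟩ :=
        MixedInteger.exists_deep_point hC hn hd hk h (by linarith)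
      refine ⟨x, hx, ?_⟩
      rintro H ⟨u, -, b, rfl⟩ hxH
      refine le_trans ?_ (hdeep u b hxH)
      gcongr
      linarith
    · obtain ⟨x, hx⟩ := hS.resolve_right (not_lt.2 hneg)
      refine ⟨x, hx, fun H _ _ => ?_⟩
      rw [ENNReal.ofReal_of_nonpos hneg, zero_mul]
      exact zero_le
  · refine ⟨100, by norm_num, fun n d hn hd C hC a k h hk => ?_⟩
    have hn1 : (1 : ℝ) ≤ n := by exact_mod_cast hn
    have hd1 : (1 : ℝ) ≤ d := by exact_mod_cast hd
    have hk0 : 0 < k := lt_of_lt_of_le (by positivity) hk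
    have hloss := MixedInteger.loss_le hn hd hk0
    have hle : (d : ℝ) ^ 2 * (n : ℝ) ^ (3 / 2 : ℝ) / k ≤ 1 / 100 := by
      rw [div_le_iff₀ hk0]; linarith
    have he : 1 / 3 < Real.exp (-1) := by
      rw [Real.exp_neg, ← one_div]
      exact one_div_lt_one_div_of_lt (Real.exp_pos 1) (by linarith [Real.exp_one_lt_d9])
    obtain ⟨⟨x, hx, hdeep⟩, h0, htop⟩ :=
      MixedInteger.exists_deep_point hC hn hd hk0 h (by linarith)
    -- Both bounds are at most `1 / 4`, which is smaller than `1 / e` minus the loss.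
    have hquarter : ENNReal.ofReal (1 / 4) ≤
        MixedInteger.oertelRadius (C ∩ MixedInteger.lattice n d) := by
      refine MixedInteger.le_oertelRadius h0 htop hx fun u => ?_
      refine le_trans ?_ (hdeep u _ le_rfl)
      gcongr
      linarith
    have hpow : (1 : ℝ) / 2 ^ n ≤ 1 / 2 := by
      refine one_div_le_one_div_of_le two_pos ?_
      simpa using pow_le_pow_right₀ (one_le_two : (1 : ℝ) ≤ 2) hn
    constructor
    · refine (ENNReal.ofReal_le_ofReal ?_).trans hquarter
      calc (1 : ℝ) / 2 ^ n * ((d : ℝ) / ((d : ℝ) + 1)) ^ d ≤ 1 / 2 * (1 / 2) := by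
            gcongr
            exact MixedInteger.div_succ_pow_le_half hd
        _ = 1 / 4 := by norm_num
    · refine (ENNReal.ofReal_le_ofReal ?_).trans hquarter
      calc (1 : ℝ) / 2 ^ n * (1 / Real.exp 1) ≤ 1 / 2 * (1 / 2) := by
            gcongr
            linarith [Real.add_one_le_exp (1 : ℝ)]
        _ = 1 / 4 := by norm_num
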